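/- **Conventions.** Let $\mathcal M$ be a model category with class $\mathcal W$ of weak equivalences. For objects $X,Y$ of $\mathcal M$ let $\mathrm{map}(X,Y)=\mathcal L^H\mathcal M(X,Y)$ be the mapping space given by the hammock localization: its $k$-simplices are commutative diagrams with $k+1$ rows, each row being a string $$X \xleftarrow{\ d_0\ } C_1 \xrightarrow{\ d_1\ } C_2 \xleftarrow{\ d_2\ }\cdots \xrightarrow{\ d_{n-2}\ } C_{n-1}\xleftarrow{\ d_{n-1}\ } Y$$ of a common odd length $n\ge 1$ (for $n=1$: $X\xleftarrow{d_0}Y$) whose arrows pointing to the left are weak equivalences, and with vertical maps from each row to the next one that are arbitrary morphisms of $\mathcal M$ and are identities on $X$ and on $Y$; such diagrams are taken modulo the equivalence relation generated by deleting a column of arrows, other than the first and the last one, that consists of identities in all rows, and composing its two neighbouring columns. Faces and degeneracies delete and repeat rows. For $f\colon A\to B$ in $\mathcal M$, the map $\mathrm{map}(f,X)=f^*\colon \mathrm{map}(B,X)\to\mathrm{map}(A,X)$ sends $B\leftarrow C_1\to\cdots\leftarrow X$ to $A\xleftarrow{\mathrm{id}}A\xrightarrow{\,f\,}B\leftarrow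 C_1\to\cdots\leftarrow X$ in every row. A monad $(T,\eta,\mu)$ on $\mathcal M$ such that $T$ preserves weak equivalences induces a monad on the homotopy category $\mathrm{Ho}(\mathcal M)=\mathcal M[\mathcal W^{-1}]$. A *homotopy $T$-algebra* $(X,a)$ is an Eilenberg–Moore algebra over this induced monad: an object $X$ of $\mathcal M$, regarded in $\mathrm{Ho}(\mathcal M)$, with a morphism $a\colon TX\to X$ in $\mathrm{Ho}(\mathcal M)$ such that $a\circ\eta_X=\mathrm{id}_X$ and $a\circ\mu_X=a\circ Ta$ in $\mathrm{Ho}(\mathcal M)$. A morphism from a map of simplicial sets $p\colon K\to L$ to a map $q\colon K'\to L'$ is a commutative square, i.e. a pair $(K\to K', L\to L')$ compatible with $p$ and $q$. Two morphisms $p\to q$ are *homotopic* if they are related by the equivalence relation generated by strict homotopies, a strict homotopy being a pair of simplicial homotopies $K\times\Delta[1]\to K'$ and $L\times\Delta[1]\to L'$ compatible with $p$ and $q$. The map $p$ is a *homotopy retract* of $q$ if there are morphisms $i\colon p\to q$ and $r\colon q\to p$ such that $r\circ i$ is homotopic to $\mathrm{id}_p$. **Theorem.** Let $\mathcal M$ be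 a model category and let $(T,\eta,\mu)$ be a monad on $\mathcal M$ such that $T$ preserves weak equivalences. Then, for every homotopy $T$-algebra $(X,a)$ and every morphism $f\colon A\to B$ of $\mathcal M$, the map $\mathrm{map}(f,X)\colon\mathrm{map}(B,X)\to\mathrm{map}(A,X)$ is a homotopy retract of the map $\mathrm{map}(Tf,X)\colon\mathrm{map}(TB,X)\to\mathrm{map}(TA,X)$. -/

import Mathlib

open CategoryTheory MonoidalCategory HomotopicalAlgebra Opposite

universe v v' u u'

namespace Hammock

section Zigzag

variable {D : Type u} [Category.{v} D]

/-- Strings of odd length `X ⟵ C₁ ⟶ C₂ ⟵ ⋯ ⟶ Cₙ₋₁ ⟵ Y` of morphisms in alternating directions,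
in which all the morphisms that point to the left belong to `W`. -/
inductive Zigzag (W : MorphismProperty D) : D → D → Type max u v
  /-- the string `X ⟵ Y` of length one -/
  | single {X Y : D} (d : Y ⟶ X) (hd : W d) : Zigzag W X Y
  /-- the string `X ⟵ C₁ ⟶ C₂ ⟵ ⋯`, where `C₂ ⟵ ⋯ ⟵ Y` is a given string -/
  | cons {X C₁ C₂ Y : D} (d : C₁ ⟶ X) (hd : W d) (e : C₁ ⟶ C₂) (z : Zigzag W C₂ Y) :
      Zigzag W X Y

namespace Zigzag

/-- The elementary reductions: an interior morphism of a string that is an identity is deleted, and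
its two neighbours, which now point in the same direction, are composed. (The first and the
last morphism of a string are not interior.) -/
inductive Red {W : MorphismProperty D} [W.IsMultiplicative] :
    ∀ {X Y : D}, Zigzag W X Y → Zigzag W X Y → Prop
  /-- `X ⟵d- C₁ -e⟶ C₂ ⟵id- C₂ -e'⟶ C₃ ⟵ ⋯` reduces to `X ⟵d- C₁ -(e ≫ e')⟶ C₃ ⟵ ⋯` -/
  | backward {X C₁ C₂ C₃ Y : D} (d : C₁ ⟶ X) (hd : W d) (e : C₁ ⟶ C₂) (e' : C₂ ⟶ C₃)
      (z : Zigzag W C₃ Y) :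
      Red (cons d hd e (cons (𝟙 C₂) (W.id_mem C₂) e' z)) (cons d hd (e ≫ e') z)
  /-- `X ⟵d- C₁ -id⟶ C₁ ⟵d'- C₃ -e⟶ C₄ ⟵ ⋯` reduces to `X ⟵(d' ≫ d)- C₃ -e⟶ C₄ ⟵ ⋯` -/
  | forward {X C₁ C₃ C₄ Y : D} (d : C₁ ⟶ X) (hd : W d) (d' : C₃ ⟶ C₁) (hd' : W d')
      (e : C₃ ⟶ C₄) (z : Zigzag W C₄ Y) :
      Red (cons d hd (𝟙 C₁) (cons d' hd' e z)) (cons (d' ≫ d) (W.comp_mem d' d hd' hd) e z)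
  /-- `X ⟵d- C₁ -id⟶ C₁ ⟵d'- Y` reduces to `X ⟵(d' ≫ d)- Y` -/
  | forward_last {X C₁ Y : D} (d : C₁ ⟶ X) (hd : W d) (d' : Y ⟶ C₁) (hd' : W d') :
      Red (cons d hd (𝟙 C₁) (single d' hd')) (single (d' ≫ d) (W.comp_mem d' d hd' hd))
  /-- reductions may take place further to the right in a string -/
  | tail {X C₁ C₂ Y : D} (d : C₁ ⟶ X) (hd : W d) (e : C₁ ⟶ C₂) {z z' : Zigzag W C₂ Y}
      (h : Red z z') : Red (cons d hd e z) (cons d hd e z')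

variable {D' : Type u'} [Category.{v'} D'] {W : MorphismProperty D} {W' : MorphismProperty D'}

/-- The image of a string under a functor that maps `W` to `W'`. -/
def map (F : D ⥤ D') (hF : W ≤ W'.inverseImage F) :
    ∀ {X Y : D}, Zigzag W X Y → Zigzag W' (F.obj X) (F.obj Y)
  | _, _, single d hd => single (F.map d) (hF d hd)
  | _, _, cons d hd e z => cons (F.map d) (hF d hd) (F.map e) (map F hF z)

lemma Red.map [W.IsMultiplicative] [W'.IsMultiplicative] (F : D ⥤ D')
    (hF : W ≤ W'.inverseImage F) {X Y : D} {z z' : Zigzag W X Y} (h : Red z z') :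
    Red (z.map F hF) (z'.map F hF) := by
  induction h with
  | backward d hd e e' z =>
    simp only [Zigzag.map, F.map_id, F.map_comp]
    exact .backward ..
  | forward d hd d' hd' e z =>
    simp only [Zigzag.map, F.map_id, F.map_comp]
    exact .forward ..
  | forward_last d hd d' hd' =>
    simp only [Zigzag.map, F.map_id, F.map_comp]
    exact .forward_last ..
  | tail d hd e h ih => exact .tail _ _ _ ih

end Zigzag

end Zigzag

section Localization

variable {C : Type u} [Category.{v} C] (W : MorphismProperty C)

/-- The constant functor `[n] ⥤ C` with value `X`. -/
abbrev const (n : ℕ) (X : C) : ComposableArrows C n := (Functor.const (Fin (n + 1))).obj X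

/-- The natural transformations between functors `[n] ⥤ C` that are objectwise in `W`. -/
abbrev levelwise (n : ℕ) : MorphismProperty (ComposableArrows C n) :=
  W.functorCategory (Fin (n + 1))

instance [W.IsMultiplicative] (n : ℕ) : (levelwise W n).IsMultiplicative where
  id_mem _ _ := W.id_mem _
  comp_mem _ _ hf hg j := W.comp_mem _ _ (hf j) (hg j)

/-- Restriction of functors `[n] ⥤ C` along a monotone map `[m] ⟶ [n]`. -/
abbrev restrict {m n : SimplexCategory} (θ : m ⟶ n) :
    ComposableArrows C n.len ⥤ ComposableArrows C m.len :=
  (Functor.whiskeringLeft _ _ C).obj (SimplexCategory.toCat.map θ).toFunctor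

lemma levelwise_le_restrict {m n : SimplexCategory} (θ : m ⟶ n) :
    levelwise W n.len ≤ (levelwise W m.len).inverseImage (restrict θ) :=
  fun _ _ _ h _ => h _

lemma Zigzag.map_restrict_id {m : SimplexCategory} {F G : ComposableArrows C m.len}
    (z : Zigzag (levelwise W m.len) F G) :
    z.map (restrict (𝟙 m)) (levelwise_le_restrict W (𝟙 m)) = z := by
  induction z with
  | single d hd => rfl
  | cons d hd e z ih => exact congrArg (Zigzag.cons d hd e) ih

lemma Zigzag.map_restrict_comp {k m n : SimplexCategory} (θ : m ⟶ n) (θ' : k ⟶ m)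
    {F G : ComposableArrows C n.len} (z : Zigzag (levelwise W n.len) F G) :
    z.map (restrict (θ' ≫ θ)) (levelwise_le_restrict W (θ' ≫ θ)) =
      (z.map (restrict θ) (levelwise_le_restrict W θ)).map (restrict θ')
        (levelwise_le_restrict W θ') := by
  induction z with
  | single d hd => rfl
  | cons d hd e z ih => exact congrArg (Zigzag.cons _ _ _) ih

/-- Hammocks of width `n` between `X` and `Y`: commutative diagrams whose `n + 1` rows are strings
`X ⟵ C₁ ⟶ ⋯ ⟶ Cₘ₋₁ ⟵ Y` of a common odd length `m` in which the arrows that point to the left are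
in `W`, and whose `n` layers of vertical maps are arbitrary maps in `C` that are identities on
`X` and on `Y`. Reading such a diagram by columns, it is a string of functors `[n] ⥤ C` from the
constant functor `X` to the constant functor `Y`. Equivalently, it is an `n`-simplex of the nerve
of the category whose objects are the strings of length `m` from `X` to `Y` and whose morphisms are
the commutative diagrams between strings that are identities on `X` and on `Y`. -/
abbrev Width (n : ℕ) (X Y : C) : Type max u v :=
  Zigzag (levelwise W n) (const n X) (const n Y)

variable [W.IsMultiplicative]

/-- The mapping space from `X` to `Y` in the hammock localization of `C` with respect to `W`: its
`n`-simplices are the hammocks of width `n` and of any odd length, modulo the equivalence relation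
generated by deleting an interior column that consists of identities in every row (and composing
the two neighbouring columns). Faces and degeneracies delete and repeat rows. -/
noncomputable def mapSpace (X Y : C) : SSet.{max u v} where
  obj Δ := Quot (fun z z' : Width W Δ.unop.len X Y => z.Red z')
  map θ := ↾(Quot.map (fun z => z.map (restrict θ.unop) (levelwise_le_restrict W θ.unop))
    (fun _ _ h => h.map _ _))
  map_id Δ := by
    ext z
    induction z using Quot.ind with | _ z
    exact congrArg (Quot.mk _) (Zigzag.map_restrict_id W z)
  map_comp θ θ' := by
    ext z
    induction z using Quot.ind with | _ z
    exact congrArg (Quot.mk _) (Zigzag.map_restrict_comp W θ.unop θ'.unop z)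

/-- The map `f^*` from the mapping space out of `B` to the mapping space out of `A` induced by
`f : A ⟶ B`: it sends `B ⟵ C₁ ⟶ ⋯ ⟵ Y` to `A ⟵id- A -f⟶ B ⟵ C₁ ⟶ ⋯ ⟵ Y`, in every row. -/
noncomputable def precomp {A B : C} (f : A ⟶ B) (Y : C) : mapSpace W B Y ⟶ mapSpace W A Y where
  app Δ := ↾(Quot.map
    (Zigzag.cons (𝟙 _) ((levelwise W Δ.unop.len).id_mem _) ((Functor.const _).map f))
    (fun _ _ h => h.tail _ _ _))
  naturality Δ Δ' θ := by
    ext z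
    induction z using Quot.ind with | _ z
    rfl

end Localization

end Hammock

namespace SimplicialMap

open Simplicial

/-- A strict homotopy between two morphisms `φ` and `ψ` (commutative squares) from `p` to `q` in the
category of maps of simplicial sets: simplicial homotopies, on the domains and on the codomains,
that are compatible with `p` and `q`. -/
def StrictlyHomotopic {p q : Arrow SSet.{u}} (φ ψ : p ⟶ q) : Prop :=
  ∃ (H : SSet.Homotopy φ.left ψ.left) (H' : SSet.Homotopy φ.right ψ.right),
    p.hom ▷ Δ[1] ≫ H'.h = H.h ≫ q.hom

/-- The equivalence relation generated by strict homotopies. -/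
def Homotopic {p q : Arrow SSet.{u}} (φ ψ : p ⟶ q) : Prop :=
  Relation.EqvGen StrictlyHomotopic φ ψ

/-- The map of simplicial sets `p` is a homotopy retract of `q`. -/
def IsHomotopyRetract (p q : Arrow SSet.{u}) : Prop :=
  ∃ (i : p ⟶ q) (r : q ⟶ p), Homotopic (i ≫ r) (𝟙 p)

end SimplicialMap

section HoMonad

variable {C : Type u} [Category.{v} C] {H : Type u'} [Category.{v'} H] (W : MorphismProperty C)
  (L : C ⥤ H) [L.IsLocalization W] (T : CategoryTheory.Monad C) (hT : W ≤ W.inverseImage T.toFunctor)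

/-- The endofunctor induced on a localization by a monad that preserves `W`. -/
noncomputable def hoFunctor : H ⥤ H :=
  Localization.lift (T.toFunctor ⋙ L) (fun _ _ f hf => Localization.inverts L W _ (hT f hf)) L

/-- The isomorphism `hoFunctor (L X) ≅ L (T X)`. -/
noncomputable def hoFunctorIso : L ⋙ hoFunctor W L T hT ≅ T.toFunctor ⋙ L :=
  Localization.fac (T.toFunctor ⋙ L) _ L

/-- The unit `L X ⟶ L (T X)` of the induced monad: the image of the unit of `T`. -/
noncomputable def hoUnit : 𝟭 H ⟶ hoFunctor W L T hT :=
  letI : Localization.Lifting L W (T.toFunctor ⋙ L) (hoFunctor W L T hT) :=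
    ⟨hoFunctorIso W L T hT⟩
  Localization.liftNatTrans L W L (T.toFunctor ⋙ L) _ _ (Functor.whiskerRight T.η L)

/-- The multiplication of the induced monad: the image of the multiplication of `T`. -/
noncomputable def hoMul : hoFunctor W L T hT ⋙ hoFunctor W L T hT ⟶ hoFunctor W L T hT :=
  letI : Localization.Lifting L W (T.toFunctor ⋙ L) (hoFunctor W L T hT) :=
    ⟨hoFunctorIso W L T hT⟩
  letI : Localization.Lifting L W (T.toFunctor ⋙ T.toFunctor ⋙ L)
      (hoFunctor W L T hT ⋙ hoFunctor W L T hT) :=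
    ⟨Functor.isoWhiskerRight (hoFunctorIso W L T hT) _ ≪≫
      Functor.isoWhiskerLeft T.toFunctor (hoFunctorIso W L T hT)⟩
  Localization.liftNatTrans L W (T.toFunctor ⋙ T.toFunctor ⋙ L) (T.toFunctor ⋙ L) _ _
    (Functor.whiskerRight T.μ L)

lemma hoUnit_app (X : C) :
    (hoUnit W L T hT).app (L.obj X) =
      L.map (T.η.app X) ≫ (hoFunctorIso W L T hT).inv.app X := by
  simp [hoUnit, Localization.liftNatTrans_app, Localization.Lifting.iso]

lemma hoMul_app (X : C) :
    (hoMul W L T hT).app (L.obj X) =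
      (hoFunctor W L T hT).map ((hoFunctorIso W L T hT).hom.app X) ≫
        (hoFunctorIso W L T hT).hom.app (T.obj X) ≫ L.map (T.μ.app X) ≫
        (hoFunctorIso W L T hT).inv.app X := by
  simp [hoMul, Localization.liftNatTrans_app, Localization.Lifting.iso]

/-- The monad induced on a localization by a monad that preserves `W`. -/
noncomputable def hoMonad : CategoryTheory.Monad H where
  toFunctor := hoFunctor W L T hT
  η := hoUnit W L T hT
  μ := hoMul W L T hT
  assoc := by
    suffices h : (Functor.whiskerRight (hoMul W L T hT) (hoFunctor W L T hT) ≫ hoMul W L T hT :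
          (hoFunctor W L T hT ⋙ hoFunctor W L T hT) ⋙ hoFunctor W L T hT ⟶ _) =
        (Functor.whiskerLeft (hoFunctor W L T hT) (hoMul W L T hT) ≫ hoMul W L T hT :
          hoFunctor W L T hT ⋙ (hoFunctor W L T hT ⋙ hoFunctor W L T hT) ⟶ _) from
      fun X => congrArg (fun τ => NatTrans.app τ X) h
    refine Localization.natTrans_ext L W (fun X => ?_)
    have h₁ := (hoMul W L T hT).naturality ((hoFunctorIso W L T hT).hom.app X)
    have h₂ := (hoFunctorIso W L T hT).hom.naturality (T.μ.app X)
    have h₃ := congrArg L.map (T.assoc X)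
    simp only [Functor.comp_map, Functor.comp_obj, Functor.map_comp] at h₁ h₂ h₃
    simp only [NatTrans.comp_app, Functor.whiskerRight_app, Functor.whiskerLeft_app]
    rw [hoMul_app, ← reassoc_of% h₁, hoMul_app]
    simp only [Functor.map_comp, Category.assoc, Functor.comp_obj]
    rw [← Functor.map_comp_assoc (hoFunctor W L T hT) ((hoFunctorIso W L T hT).inv.app X),
      Iso.inv_hom_id_app, CategoryTheory.Functor.map_id, Category.id_comp, reassoc_of% h₂,
      reassoc_of% h₃, Iso.inv_hom_id_app_assoc]
  left_unit := by
    suffices h : (Functor.whiskerLeft (hoFunctor W L T hT) (hoUnit W L T hT) ≫ hoMul W L T hT :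
        hoFunctor W L T hT ⋙ 𝟭 H ⟶ hoFunctor W L T hT) = 𝟙 (hoFunctor W L T hT) from
      fun X => congrArg (fun τ => NatTrans.app τ X) h
    refine Localization.natTrans_ext L W (fun X => ?_)
    have h₁ := (hoUnit W L T hT).naturality ((hoFunctorIso W L T hT).hom.app X)
    have h₂ := congrArg L.map (T.left_unit X)
    simp only [Functor.id_map, Functor.id_obj, Functor.comp_obj, Functor.map_comp,
      CategoryTheory.Functor.map_id] at h₁ h₂
    simp only [NatTrans.comp_app, Functor.whiskerLeft_app, NatTrans.id_app]
    rw [hoMul_app, ← reassoc_of% h₁, hoUnit_app]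
    simp only [Category.assoc, Functor.comp_obj]
    rw [Iso.inv_hom_id_app_assoc, reassoc_of% h₂, Iso.hom_inv_id_app]
    rfl
  right_unit := by
    suffices h : (Functor.whiskerRight (hoUnit W L T hT) (hoFunctor W L T hT) ≫ hoMul W L T hT :
        𝟭 H ⋙ hoFunctor W L T hT ⟶ hoFunctor W L T hT) = 𝟙 (hoFunctor W L T hT) from
      fun X => congrArg (fun τ => NatTrans.app τ X) h
    refine Localization.natTrans_ext L W (fun X => ?_)
    have h₁ := (hoFunctorIso W L T hT).hom.naturality (T.η.app X)
    have h₂ := congrArg L.map (T.right_unit X)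
    simp only [Functor.id_obj, Functor.comp_map, Functor.comp_obj, Functor.map_comp,
      CategoryTheory.Functor.map_id] at h₁ h₂
    simp only [NatTrans.comp_app, Functor.whiskerRight_app, NatTrans.id_app]
    rw [hoMul_app, hoUnit_app]
    simp only [Functor.map_comp, Category.assoc, Functor.comp_obj]
    rw [← Functor.map_comp_assoc (hoFunctor W L T hT) ((hoFunctorIso W L T hT).inv.app X),
      Iso.inv_hom_id_app, CategoryTheory.Functor.map_id, Category.id_comp, reassoc_of% h₁,
      reassoc_of% h₂, Iso.hom_inv_id_app]
    rfl

end HoMonad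

/-! Concatenation of hammocks is associative and unital on reduction classes, so mapping spaces
compose, and f^* is composition with f on the left; it therefore commutes with every composition on
the right. Let a be a vertex of map(TX, X) representing the structure map. Writing compositions from
source to target, the retraction is given by i(z) = T z · a and r = η^*, so that r i (z) = η_B · T z
· a for z in map(B, X).

Two homotopies connect this with z. Naturality of η yields one from z · η_X to η_B · T z
(`twistHomotopy`): a simplex of Δ[1] is a monotone map σ to [1], row j of the hammock is kept or
replaced by its image under T according to σ(j), and η supplies the vertical maps from kept rows to
replaced ones. The other connects z · η_X · a with z, and exists as soon as η_X · a and the identity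
lie in one component of map(X, X) (`homotopic_postcompArrow`).

The last condition is the unit law of the algebra. The components of the mapping spaces form a
category in which weak equivalences become invertible (`toComponentCat_inverts`), so the homotopy
category maps to it and the unit law can be transported there (`exists_vertex_of_localization`). All
constructions are compatible with f^*, hence they are maps and homotopies of squares. -/

namespace Hammock

/-! ### Concatenation of strings and its compatibility with reductions -/

section Strings

variable {D : Type u} [Category.{v} D] {W : MorphismProperty D}

namespace Zigzag

lemma map_id {X Y : D} (z : Zigzag W X Y) : z.map (𝟭 D) le_rfl = z := by
  induction z with
  | single d hd => rfl
  | cons d hd e z ih => exact congrArg (Zigzag.cons d hd e) ih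

variable [W.IsMultiplicative]

/-- Composition of the first morphism of a string with a further morphism in `W`. -/
def extend {X X' Y : D} (d : X ⟶ X') (hd : W d) : Zigzag W X Y → Zigzag W X' Y
  | single d' hd' => single (d' ≫ d) (W.comp_mem d' d hd' hd)
  | cons d' hd' e z => cons (d' ≫ d) (W.comp_mem d' d hd' hd) e z

/-- Concatenation of strings: the last morphism of the first string is composed with the
first morphism of the second string. -/
def concat {Z : D} : ∀ {X Y : D}, Zigzag W X Y → Zigzag W Y Z → Zigzag W X Z
  | _, _, single d hd, w => extend d hd w
  | _, _, cons d hd e z, w => cons d hd e (concat z w)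

lemma extend_id {X Y : D} (z : Zigzag W X Y) : z.extend (𝟙 X) (W.id_mem X) = z := by
  cases z <;> simp [extend]

lemma extend_extend {X X' X'' Y : D} (d : X ⟶ X') (hd : W d) (d' : X' ⟶ X'') (hd' : W d')
    (z : Zigzag W X Y) :
    (z.extend d hd).extend d' hd' = z.extend (d ≫ d') (W.comp_mem d d' hd hd') := by
  cases z <;> simp [extend]

lemma extend_concat {X X' Y Z : D} (d : X ⟶ X') (hd : W d) (z : Zigzag W X Y)
    (w : Zigzag W Y Z) : (z.extend d hd).concat w = (z.concat w).extend d hd := by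
  cases z with
  | single d' hd' => exact (extend_extend ..).symm
  | cons d' hd' e z => rfl

lemma concat_assoc {X Y Z Z' : D} (x : Zigzag W X Y) (y : Zigzag W Y Z) (z : Zigzag W Z Z') :
    (x.concat y).concat z = x.concat (y.concat z) := by
  induction x with
  | single d hd => simp [concat, extend_concat]
  | cons d hd e x ih => simp [concat, ih]

lemma concat_single_id {X Y : D} (z : Zigzag W X Y) :
    z.concat (single (𝟙 Y) (W.id_mem Y)) = z := by
  induction z with
  | single d hd => simp [concat, extend]
  | cons d hd e x ih => simp [concat, ih]

lemma Red.extend {X X' Y : D} (d : X ⟶ X') (hd : W d) {z z' : Zigzag W X Y} (h : Red z z') :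
    Red (z.extend d hd) (z'.extend d hd) := by
  cases h with
  | backward d hd e e' z => exact .backward ..
  | forward d hd d' hd' e z => simpa [Zigzag.extend] using Red.forward ..
  | forward_last d hd d' hd' => simpa [Zigzag.extend] using Red.forward_last ..
  | tail d hd e h => exact .tail _ _ _ h

/-- Concatenation turns the last morphism of the left string into an interior one, so a reduction
`forward_last` there becomes `forward` when the right string is longer than one. Both outcomes are
needed at once for `Red.concat_right`. -/
lemma red_extend {X C₁ Y : D} (d : C₁ ⟶ X) (hd : W d) (d' : Y ⟶ C₁) (hd' : W d') {Z : D}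
    (w : Zigzag W Y Z) :
    Red (cons d hd (𝟙 C₁) (w.extend d' hd')) (w.extend (d' ≫ d) (W.comp_mem d' d hd' hd)) := by
  cases w with
  | single d'' hd'' =>
    simp only [Zigzag.extend, ← Category.assoc]
    exact .forward_last ..
  | cons d'' hd'' e z =>
    simp only [Zigzag.extend, ← Category.assoc]
    exact .forward ..

lemma Red.concat_right {X Y Z : D} {z z' : Zigzag W X Y} (h : Red z z') (w : Zigzag W Y Z) :
    Red (z.concat w) (z'.concat w) := by
  induction h with
  | backward d hd e e' z => exact .backward ..
  | forward d hd d' hd' e z => exact .forward ..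
  | forward_last d hd d' hd' => exact red_extend ..
  | tail d hd e h ih => exact .tail _ _ _ (ih w)

lemma Red.concat_left {X Y Z : D} (z : Zigzag W X Y) {w w' : Zigzag W Y Z} (h : Red w w') :
    Red (z.concat w) (z.concat w') := by
  induction z with
  | single d hd => exact h.extend d hd
  | cons d hd e z ih => exact .tail _ _ _ (ih h)

end Zigzag

variable [W.IsMultiplicative]

variable (W) in
/-- Strings modulo reductions. -/
abbrev ReducedZigzag (X Y : D) : Type max u v := Quot (fun z z' : Zigzag W X Y => z.Red z')

namespace ReducedZigzag

/-- Composition of reduction classes of strings by concatenation. -/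
def comp {X Y Z : D} :
    ReducedZigzag W X Y → ReducedZigzag W Y Z → ReducedZigzag W X Z :=
  Quot.map₂ Zigzag.concat (fun z _ _ h => h.concat_left z) (fun _ _ w h => h.concat_right w)

/-- The class of the string `X ⟵id- X -f⟶ Y ⟵id- Y`. -/
def ofHom {X Y : D} (f : X ⟶ Y) : ReducedZigzag W X Y :=
  Quot.mk _ (.cons (𝟙 X) (W.id_mem X) f (.single (𝟙 Y) (W.id_mem Y)))

/-- The class of the string `X ⟵d- Y`. -/
def ofInv {X Y : D} (d : Y ⟶ X) (hd : W d) : ReducedZigzag W X Y :=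
  Quot.mk _ (.single d hd)

/-- The string `X ⟵id- A -f⟶ B ⟵ ⋯` obtained from `B ⟵ ⋯`. -/
def precomp {X Y Z : D} (f : X ⟶ Y) : ReducedZigzag W Y Z → ReducedZigzag W X Z :=
  Quot.map (Zigzag.cons (𝟙 _) (W.id_mem _) f) (fun _ _ h => h.tail _ _ _)

lemma comp_assoc {X Y Z Z' : D} (x : ReducedZigzag W X Y) (y : ReducedZigzag W Y Z)
    (z : ReducedZigzag W Z Z') : (x.comp y).comp z = x.comp (y.comp z) := by
  obtain ⟨x⟩ := x
  obtain ⟨y⟩ := y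
  obtain ⟨z⟩ := z
  exact congrArg (Quot.mk _) (x.concat_assoc y z)

lemma ofHom_comp {X Y Z : D} (f : X ⟶ Y) (z : ReducedZigzag W Y Z) :
    (ofHom f).comp z = z.precomp f := by
  obtain ⟨z⟩ := z
  exact congrArg (fun w => Quot.mk _ (Zigzag.cons (𝟙 X) (W.id_mem X) f w)) z.extend_id

lemma precomp_comp {X Y Z Z' : D} (f : X ⟶ Y) (y : ReducedZigzag W Y Z)
    (z : ReducedZigzag W Z Z') : (y.precomp f).comp z = (y.comp z).precomp f := by
  rw [← ofHom_comp, comp_assoc, ofHom_comp]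

lemma precomp_precomp {X Y Z Z' : D} (f : X ⟶ Y) (g : Y ⟶ Z) (z : ReducedZigzag W Z Z') :
    (z.precomp g).precomp f = z.precomp (f ≫ g) := by
  obtain ⟨z⟩ := z
  exact Quot.sound (.backward ..)

lemma ofHom_comp_ofHom {X Y Z : D} (f : X ⟶ Y) (g : Y ⟶ Z) :
    (ofHom (W := W) f).comp (ofHom g) = ofHom (f ≫ g) := by
  rw [ofHom_comp]
  exact Quot.sound (.backward ..)

/-- The string of length one on an identity is a unit for concatenation already before reduction;
the unit laws for `ofHom (𝟙 X)` follow by replacing it with that string. -/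
lemma ofHom_id (X : D) : ofHom (W := W) (𝟙 X) = ofInv (𝟙 X) (W.id_mem X) := by
  refine (Quot.sound (.forward_last ..)).trans ?_
  simp only [Category.comp_id]
  rfl

lemma ofHom_id_comp {X Y : D} (z : ReducedZigzag W X Y) : (ofHom (𝟙 X)).comp z = z := by
  rw [ofHom_id]
  obtain ⟨z⟩ := z
  exact congrArg (Quot.mk _) z.extend_id

lemma comp_ofHom_id {X Y : D} (z : ReducedZigzag W X Y) : z.comp (ofHom (𝟙 Y)) = z := by
  rw [ofHom_id]
  obtain ⟨z⟩ := z
  exact congrArg (Quot.mk _) z.concat_single_id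

end ReducedZigzag

lemma Zigzag.map_extend {D' : Type u'} [Category.{v'} D'] {W' : MorphismProperty D'}
    [W'.IsMultiplicative] (F : D ⥤ D') (hF : W ≤ W'.inverseImage F) {X X' Y : D} (d : X ⟶ X')
    (hd : W d) (z : Zigzag W X Y) :
    (z.extend d hd).map F hF = (z.map F hF).extend (F.map d) (hF d hd) := by
  cases z <;> simp [extend, map]

lemma Zigzag.map_concat {D' : Type u'} [Category.{v'} D'] {W' : MorphismProperty D'}
    [W'.IsMultiplicative] (F : D ⥤ D') (hF : W ≤ W'.inverseImage F) {X Y Z : D}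
    (z : Zigzag W X Y) (w : Zigzag W Y Z) :
    (z.concat w).map F hF = (z.map F hF).concat (w.map F hF) := by
  induction z with
  | single d hd => exact map_extend F hF d hd w
  | cons d hd e z ih => exact congrArg (Zigzag.cons _ _ _) (ih w)

namespace ReducedZigzag

variable {D' : Type u'} [Category.{v'} D'] {W' : MorphismProperty D'} [W'.IsMultiplicative]

/-- The image of a reduction class of strings under a functor that maps `W` to `W'`. -/
def map (F : D ⥤ D') (hF : W ≤ W'.inverseImage F) {X Y : D} :
    ReducedZigzag W X Y → ReducedZigzag W' (F.obj X) (F.obj Y) :=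
  Quot.map (fun z => z.map F hF) (fun _ _ h => h.map F hF)

lemma map_comp (F : D ⥤ D') (hF : W ≤ W'.inverseImage F) {X Y Z : D} (x : ReducedZigzag W X Y)
    (y : ReducedZigzag W Y Z) : (x.comp y).map F hF = (x.map F hF).comp (y.map F hF) := by
  obtain ⟨x⟩ := x
  obtain ⟨y⟩ := y
  exact congrArg (Quot.mk _) (x.map_concat F hF y)

lemma map_ofHom (F : D ⥤ D') (hF : W ≤ W'.inverseImage F) {X Y : D} (f : X ⟶ Y) :
    (ofHom f).map F hF = ofHom (W := W') (F.map f) := by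
  simp [ofHom, map, Quot.map, Zigzag.map]

lemma map_precomp (F : D ⥤ D') (hF : W ≤ W'.inverseImage F) {X Y Z : D} (f : X ⟶ Y)
    (z : ReducedZigzag W Y Z) : (z.precomp f).map F hF = (z.map F hF).precomp (F.map f) := by
  rw [← ofHom_comp, map_comp, map_ofHom, ofHom_comp]

lemma map_id {X Y : D} (z : ReducedZigzag W X Y) : z.map (𝟭 D) le_rfl = z := by
  obtain ⟨z⟩ := z
  exact congrArg (Quot.mk _) z.map_id

/-- The image of a reduction class of strings under a functor, with ends modified along
given morphisms. -/
def conj (F : D ⥤ D') (hF : W ≤ W'.inverseImage F) {X Y : D} {X' Y' : D'} (a : X' ⟶ F.obj X)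
    (b : F.obj Y ⟶ Y') (z : ReducedZigzag W X Y) : ReducedZigzag W' X' Y' :=
  ((z.map F hF).comp (ofHom b)).precomp a

lemma precomp_conj (F : D ⥤ D') (hF : W ≤ W'.inverseImage F) {X Y : D} {X' X'' Y' : D'}
    (c : X'' ⟶ X') (a : X' ⟶ F.obj X) (b : F.obj Y ⟶ Y') (z : ReducedZigzag W X Y) :
    (z.conj F hF a b).precomp c = z.conj F hF (c ≫ a) b :=
  precomp_precomp _ _ _

lemma conj_precomp (F : D ⥤ D') (hF : W ≤ W'.inverseImage F) {X₀ X Y : D} {X' Y' : D'}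
    (f : X₀ ⟶ X) (a : X' ⟶ F.obj X₀) (b : F.obj Y ⟶ Y') (z : ReducedZigzag W X Y) :
    (z.precomp f).conj F hF a b = z.conj F hF (a ≫ F.map f) b := by
  rw [conj, map_precomp, precomp_comp, precomp_precomp, conj]

lemma conj_id {X Y Y' : D} (b : Y ⟶ Y') (z : ReducedZigzag W X Y) :
    z.conj (𝟭 D) le_rfl (𝟙 X) b = z.comp (ofHom b) := by
  refine (congrArg (fun w => (ReducedZigzag.comp w (ofHom b)).precomp (𝟙 X)) z.map_id).trans ?_
  exact (ofHom_comp _ _).symm.trans (ofHom_id_comp _)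

/-- An equality of functors changes the ends of the image string. The end morphisms absorb the
transports, so both sides have the same type. -/
lemma conj_congr {F G : D ⥤ D'} (h : F = G) (hF : W ≤ W'.inverseImage F)
    (hG : W ≤ W'.inverseImage G) {X Y : D} {X' Y' : D'}
    (a : X' ⟶ F.obj X) (b : F.obj Y ⟶ Y') (z : ReducedZigzag W X Y) :
    z.conj F hF a b =
      z.conj G hG (a ≫ eqToHom (by rw [h])) (eqToHom (by rw [h]) ≫ b) := by
  subst h
  simp

end ReducedZigzag

end Strings

/-! ### Composition of simplices of mapping spaces -/

section MapSpace

open Simplicial ReducedZigzag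

variable {C : Type u} [Category.{v} C] {W : MorphismProperty C} [W.IsMultiplicative]

/-- Composition of simplices of mapping spaces. -/
noncomputable def mapComp {X Y Z : C} {Δ : SimplexCategoryᵒᵖ} (x : (mapSpace W X Y).obj Δ)
    (y : (mapSpace W Y Z).obj Δ) : (mapSpace W X Z).obj Δ :=
  ReducedZigzag.comp x y

/-- The simplices of mapping spaces given by morphisms of `C`. -/
noncomputable def mapOfHom (W : MorphismProperty C) [W.IsMultiplicative] {X Y : C} (f : X ⟶ Y)
    (Δ : SimplexCategoryᵒᵖ) : (mapSpace W X Y).obj Δ :=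
  ReducedZigzag.ofHom (W := levelwise W Δ.unop.len) ((Functor.const _).map f)

lemma mapComp_assoc {X Y Z Z' : C} {Δ : SimplexCategoryᵒᵖ} (x : (mapSpace W X Y).obj Δ)
    (y : (mapSpace W Y Z).obj Δ) (z : (mapSpace W Z Z').obj Δ) :
    mapComp (mapComp x y) z = mapComp x (mapComp y z) :=
  comp_assoc _ _ _

lemma map_mapComp {X Y Z : C} {Δ Δ' : SimplexCategoryᵒᵖ} (θ : Δ ⟶ Δ')
    (x : (mapSpace W X Y).obj Δ) (y : (mapSpace W Y Z).obj Δ) :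
    (mapSpace W X Z).map θ (mapComp x y) =
      mapComp ((mapSpace W X Y).map θ x) ((mapSpace W Y Z).map θ y) :=
  ReducedZigzag.map_comp (restrict θ.unop) (levelwise_le_restrict W θ.unop) _ _

lemma mapOfHom_mapComp {X Y Z : C} (f : X ⟶ Y) {Δ : SimplexCategoryᵒᵖ}
    (y : (mapSpace W Y Z).obj Δ) :
    mapComp (mapOfHom W f Δ) y = (precomp W f Z).app Δ y :=
  ofHom_comp _ _

lemma mapComp_mapOfHom_id {X Y : C} {Δ : SimplexCategoryᵒᵖ} (x : (mapSpace W X Y).obj Δ) :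
    mapComp x (mapOfHom W (𝟙 Y) Δ) = x :=
  comp_ofHom_id _

lemma mapOfHom_id_mapComp {X Y : C} {Δ : SimplexCategoryᵒᵖ} (x : (mapSpace W X Y).obj Δ) :
    mapComp (mapOfHom W (𝟙 X) Δ) x = x :=
  ofHom_id_comp _

lemma mapOfHom_comp {X Y Z : C} (f : X ⟶ Y) (g : Y ⟶ Z) (Δ : SimplexCategoryᵒᵖ) :
    mapOfHom W (f ≫ g) Δ = mapComp (mapOfHom W f Δ) (mapOfHom W g Δ) := by
  refine Eq.trans ?_ (ofHom_comp_ofHom _ _).symm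
  rw [← Functor.map_comp]
  rfl

lemma precomp_mapComp {X Y Z Z' : C} (f : X ⟶ Y) {Δ : SimplexCategoryᵒᵖ}
    (y : (mapSpace W Y Z).obj Δ) (z : (mapSpace W Z Z').obj Δ) :
    (precomp W f Z').app Δ (mapComp y z) = mapComp ((precomp W f Z).app Δ y) z :=
  (ReducedZigzag.precomp_comp _ _ _).symm

lemma precomp_app_precomp_app {X Y Z Z' : C} (f : X ⟶ Y) (g : Y ⟶ Z) {Δ : SimplexCategoryᵒᵖ}
    (z : (mapSpace W Z Z').obj Δ) :
    (precomp W f Z').app Δ ((precomp W g Z').app Δ z) = (precomp W (f ≫ g) Z').app Δ z := by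
  rw [← mapOfHom_mapComp, ← mapOfHom_mapComp, ← mapOfHom_mapComp, ← mapComp_assoc,
    mapOfHom_comp]

/-- The degenerate simplex on a vertex. -/
noncomputable def degenerate {X Y : C} (x : (mapSpace W X Y).obj (op ⦋0⦌))
    (Δ : SimplexCategoryᵒᵖ) : (mapSpace W X Y).obj Δ :=
  (mapSpace W X Y).map (SimplexCategory.const Δ.unop ⦋0⦌ 0).op x

lemma map_degenerate {X Y : C} (x : (mapSpace W X Y).obj (op ⦋0⦌))
    {Δ Δ' : SimplexCategoryᵒᵖ} (θ : Δ ⟶ Δ') :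
    (mapSpace W X Y).map θ (degenerate x Δ) = degenerate x Δ' :=
  ((mapSpace W X Y).map_comp_apply _ _ x).symm

lemma degenerate_mapComp {X Y Z : C} (x : (mapSpace W X Y).obj (op ⦋0⦌))
    (y : (mapSpace W Y Z).obj (op ⦋0⦌)) (Δ : SimplexCategoryᵒᵖ) :
    degenerate (mapComp x y) Δ = mapComp (degenerate x Δ) (degenerate y Δ) :=
  map_mapComp _ _ _

lemma degenerate_zero {X Y : C} (x : (mapSpace W X Y).obj (op ⦋0⦌)) :
    degenerate x (op ⦋0⦌) = x := by
  rw [degenerate, SimplexCategory.const_eq_id]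
  exact (mapSpace W X Y).map_id_apply _ x

/-- Two vertices of a mapping space that are the ends of an edge. -/
def Edge {X Y : C} (x y : (mapSpace W X Y).obj (op ⦋0⦌)) : Prop :=
  ∃ w : (mapSpace W X Y).obj (op ⦋1⦌),
    (mapSpace W X Y).map (SimplexCategory.const ⦋0⦌ ⦋1⦌ 0).op w = x ∧
      (mapSpace W X Y).map (SimplexCategory.const ⦋0⦌ ⦋1⦌ 1).op w = y

lemma Edge.mapComp_left {X Y Z : C} (x : (mapSpace W X Y).obj (op ⦋0⦌))
    {y y' : (mapSpace W Y Z).obj (op ⦋0⦌)} (h : Edge y y') :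
    Edge (mapComp x y) (mapComp x y') := by
  obtain ⟨w, rfl, rfl⟩ := h
  refine ⟨mapComp (degenerate x _) w, ?_, ?_⟩ <;>
    rw [map_mapComp, map_degenerate, degenerate_zero]

lemma Edge.mapComp_right {X Y Z : C} {x x' : (mapSpace W X Y).obj (op ⦋0⦌)}
    (y : (mapSpace W Y Z).obj (op ⦋0⦌)) (h : Edge x x') :
    Edge (mapComp x y) (mapComp x' y) := by
  obtain ⟨w, rfl, rfl⟩ := h
  refine ⟨mapComp w (degenerate y _), ?_, ?_⟩ <;>
    rw [map_mapComp, map_degenerate, degenerate_zero]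

end MapSpace

/-! ### The category of components inverts weak equivalences -/

section Components

open Simplicial ReducedZigzag

variable {C : Type u} [Category.{v} C] {W : MorphismProperty C} [W.IsMultiplicative]

/-- The category with the same objects as `C` in which the morphisms are the connected components
of the mapping spaces. -/
@[nolint unusedArguments]
structure ComponentCat (_ : MorphismProperty C) where
  /-- The underlying object of `C`. -/
  as : C

noncomputable instance : Category.{max u v} (ComponentCat W) where
  Hom X Y := Quot (Edge (W := W) (X := X.as) (Y := Y.as))
  id X := Quot.mk _ (mapOfHom W (𝟙 X.as) _)
  comp := Quot.map₂ mapComp (fun x _ _ h => h.mapComp_left x) (fun _ _ y h => h.mapComp_right y)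
  id_comp := by
    rintro _ _ ⟨x⟩
    exact congrArg (Quot.mk _) (mapOfHom_id_mapComp x)
  comp_id := by
    rintro _ _ ⟨x⟩
    exact congrArg (Quot.mk _) (mapComp_mapOfHom_id x)
  assoc := by
    rintro _ _ _ _ ⟨x⟩ ⟨y⟩ ⟨z⟩
    exact congrArg (Quot.mk _) (mapComp_assoc x y z)

variable (W) in
/-- The functor from `C` to the category of connected components of mapping spaces. -/
noncomputable def toComponentCat : C ⥤ ComponentCat W where
  obj X := ⟨X⟩
  map f := Quot.mk _ (mapOfHom W f _)
  map_id _ := rfl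
  map_comp f g := congrArg (Quot.mk _) (mapOfHom_comp f g _)

/-- The vertex of a mapping space given by a morphism in `W` with the opposite direction. -/
noncomputable def vertexOfInv {X Y : C} (f : X ⟶ Y) (hf : W f) :
    (mapSpace W Y X).obj (op ⦋0⦌) :=
  Quot.mk _ (.single ((Functor.const _).map f) (fun _ => hf))

/-- Serves to identify the two rows of an explicit hammock of width one: a vertex of a diagram [1] ⥤
C, seen as a diagram [0] ⥤ C, equals a constant diagram only up to `eqToHom`. -/
lemma Zigzag.cons_single_congr {D : Type*} [Category* D] {W : MorphismProperty D}
    {X Y C₁ C₂ C₁' C₂' : D} (h₁ : C₁' = C₁) (h₂ : C₂ = C₂') {d : C₁ ⟶ X} {d₁ : C₁' ⟶ X}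
    {e : C₁ ⟶ C₂} {e₁ : C₁' ⟶ C₂'} {d' : Y ⟶ C₂} {d₁' : Y ⟶ C₂'} (hd : W d) (hd' : W d')
    (hd₁ : W d₁) (hd₁' : W d₁') (h : eqToHom h₁ ≫ d = d₁)
    (he : eqToHom h₁ ≫ e ≫ eqToHom h₂ = e₁) (h' : d' ≫ eqToHom h₂ = d₁') :
    Zigzag.cons d hd e (.single d' hd') = Zigzag.cons d₁ hd₁ e₁ (.single d₁' hd₁') := by
  subst h₁ h₂ h he h'
  simp

lemma edge_id_comp_vertexOfInv {X Y : C} (f : X ⟶ Y) (hf : W f) :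
    Edge (mapOfHom W (𝟙 X) _) (mapComp (mapOfHom W f _) (vertexOfInv f hf)) := by
  let u : const 1 X ⟶ ComposableArrows.mk₁ f :=
    ComposableArrows.homMk₁ (𝟙 X) f (by simp; rfl)
  have hu : levelwise W 1 u := fun i => by
    fin_cases i
    · exact W.id_mem X
    · exact hf
  -- Row 0 is X = X = X = X and row 1 is X = X -f⟶ Y ⟵f- X; the only vertical map that is not an
  -- identity is f, in the column C₂.
  refine ⟨Quot.mk _ (.cons (𝟙 _) ((levelwise W 1).id_mem _) u (.single u hu)), ?_, ?_⟩
  · refine congrArg (Quot.mk _) (Zigzag.cons_single_congr rfl (ComposableArrows.ext₀ rfl)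
      _ _ _ _ ?_ ?_ ?_)
    all_goals
      ext
      simp [u]
    all_goals rfl
  · refine congrArg (Quot.mk _) (Zigzag.cons_single_congr rfl (ComposableArrows.ext₀ rfl)
      _ _ _ _ ?_ ?_ ?_)
    all_goals
      ext
      simp [u]
    all_goals rfl

lemma edge_vertexOfInv_comp {X Y : C} (f : X ⟶ Y) (hf : W f) :
    Edge (mapComp (vertexOfInv f hf) (mapOfHom W f _)) (mapOfHom W (𝟙 Y) _) := by
  let u : ComposableArrows.mk₁ f ⟶ const 1 Y :=
    ComposableArrows.homMk₁ f (𝟙 Y) (by simp; rfl)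
  have hu : levelwise W 1 u := fun i => by
    fin_cases i
    · exact hf
    · exact W.id_mem Y
  -- Row 0 is Y ⟵f- X -f⟶ Y = Y and row 1 consists of identities of Y; the only vertical map that is
  -- not an identity is f, in the column C₁.
  refine ⟨Quot.mk _ (.cons u hu u (.single (𝟙 _) ((levelwise W 1).id_mem _))), ?_, ?_⟩
  · refine congrArg (Quot.mk _) (Zigzag.cons_single_congr (ComposableArrows.ext₀ rfl) rfl
      _ _ _ _ ?_ ?_ ?_)
    all_goals
      ext
      simp [u]
    all_goals rfl
  · refine congrArg (Quot.mk _) (Zigzag.cons_single_congr (ComposableArrows.ext₀ rfl) rfl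
      _ _ _ _ ?_ ?_ ?_)
    all_goals
      ext
      simp [u]
    all_goals rfl

lemma toComponentCat_inverts : W.IsInvertedBy (toComponentCat W) := fun _ _ f hf =>
  ⟨Quot.mk _ (vertexOfInv f hf), (Quot.sound (edge_id_comp_vertexOfInv f hf)).symm,
    Quot.sound (edge_vertexOfInv_comp f hf)⟩

end Components

/-! ### The homotopy induced by a natural transformation -/

section Twist

open Simplicial ReducedZigzag

variable {C : Type u} [Category.{v} C] {W : MorphismProperty C}

/-- The functor that applies to each vertex of a diagram `[n] ⥤ C` one of the two functors `E 0` and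
`E 1`, as prescribed by a map `[n] ⟶ [1]`. -/
abbrev twist (E : ComposableArrows (C ⥤ C) 1) {m : SimplexCategory} (σ : m ⟶ ⦋1⦌) :
    ComposableArrows C m.len ⥤ ComposableArrows C m.len where
  obj F :=
    { obj i := (E.obj (σ.toOrderHom i)).obj (F.obj i)
      map {i j} g := (E.map (homOfLE (σ.toOrderHom.monotone (leOfHom g)))).app (F.obj i) ≫
        (E.obj (σ.toOrderHom j)).map (F.map g)
      map_id i := by
        rw [Subsingleton.elim (homOfLE _) (𝟙 (σ.toOrderHom i))]
        simp
      map_comp {i j k} g h := by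
        rw [Subsingleton.elim (homOfLE _) (homOfLE (σ.toOrderHom.monotone (leOfHom g)) ≫
          homOfLE (σ.toOrderHom.monotone (leOfHom h))), E.map_comp]
        simp only [NatTrans.comp_app, Functor.map_comp, Category.assoc, NatTrans.naturality_assoc] }
  map φ :=
    { app i := (E.obj (σ.toOrderHom i)).map (φ.app i)
      naturality i j f := by
        simp only [Category.assoc, NatTrans.naturality_assoc, ← Functor.map_comp,
          NatTrans.naturality] }

lemma levelwise_le_twist (E : ComposableArrows (C ⥤ C) 1)
    (hE : ∀ i, W ≤ W.inverseImage (E.obj i)) {m : SimplexCategory} (σ : m ⟶ ⦋1⦌) :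
    levelwise W m.len ≤ (levelwise W m.len).inverseImage (twist E σ) :=
  fun _ _ _ h i => hE _ _ (h i)

/-- The morphism given by `E 0 ⟶ E i` at the vertices over `i`. -/
def toTwist (E : ComposableArrows (C ⥤ C) 1) {m : SimplexCategory} (σ : m ⟶ ⦋1⦌) (X : C) :
    const m.len ((E.obj 0).obj X) ⟶ (twist E σ).obj (const m.len X) where
  app i := (E.map (homOfLE (Fin.zero_le (σ.toOrderHom i)))).app X
  naturality i j f := by
    simp [← NatTrans.comp_app, ← Functor.map_comp]

/-- The morphism given by `E i ⟶ E 1` at the vertices over `i`. -/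
def fromTwist (E : ComposableArrows (C ⥤ C) 1) {m : SimplexCategory} (σ : m ⟶ ⦋1⦌) (X : C) :
    (twist E σ).obj (const m.len X) ⟶ const m.len ((E.obj 1).obj X) where
  app i := (E.map (homOfLE (Fin.le_last (σ.toOrderHom i)))).app X
  naturality i j f := by
    simp [← NatTrans.comp_app, ← Functor.map_comp]

/-- The identities of `E 1` at all vertices. -/
def toTwistOne (E : ComposableArrows (C ⥤ C) 1) (m : SimplexCategory) (X : C) :
    const m.len ((E.obj 1).obj X) ⟶
      (twist E (SimplexCategory.const m ⦋1⦌ 1)).obj (const m.len X) where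
  app i := 𝟙 _
  naturality i j f := by
    change 𝟙 _ ≫ 𝟙 _ = 𝟙 _ ≫ (E.map (homOfLE le_rfl)).app X ≫ (E.obj 1).map (𝟙 X)
    simp

variable (E : ComposableArrows (C ⥤ C) 1)

lemma map_toTwist {m : SimplexCategory} (σ : m ⟶ ⦋1⦌) {X Y : C} (f : X ⟶ Y) :
    (Functor.const _).map ((E.obj 0).map f) ≫ toTwist E σ Y =
      toTwist E σ X ≫ (twist E σ).map ((Functor.const _).map f) := by
  ext i
  simp [toTwist]

lemma map_toTwistOne (m : SimplexCategory) {X Y : C} (f : X ⟶ Y) :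
    (Functor.const _).map ((E.obj 1).map f) ≫ toTwistOne E m Y =
      toTwistOne E m X ≫ (twist E _).map ((Functor.const _).map f) := by
  ext i
  simp [toTwistOne]

lemma map_comp_toTwistOne (m : SimplexCategory) (X : C) :
    (Functor.const _).map ((E.map (homOfLE (Fin.zero_le 1))).app X) ≫ toTwistOne E m X =
      toTwist E (SimplexCategory.const m ⦋1⦌ 1) X := by
  ext i
  exact Category.comp_id _

lemma Zigzag.map_twist_map_restrict (hE : ∀ i, W ≤ W.inverseImage (E.obj i))
    {m n : SimplexCategory} (θ : m ⟶ n) (σ : n ⟶ ⦋1⦌) {F G : ComposableArrows C n.len}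
    (z : Zigzag (levelwise W n.len) F G) :
    (z.map (twist E σ) (levelwise_le_twist E hE σ)).map (restrict θ) (levelwise_le_restrict W θ) =
      (z.map (restrict θ) (levelwise_le_restrict W θ)).map (twist E (θ ≫ σ))
        (levelwise_le_twist E hE (θ ≫ σ)) := by
  induction z with
  | single d hd => rfl
  | cons d hd e z ih => exact congrArg (Zigzag.cons _ _ _) ih

variable [W.IsMultiplicative] (hE : ∀ i, W ≤ W.inverseImage (E.obj i))

/-- Choosing functors row by row commutes with deleting and repeating rows, provided σ is pulled
back along θ as well. This is what makes `mapOne` and `twistHomotopy` simplicial. -/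
lemma map_conj_twist {m n : SimplexCategory} (θ : m ⟶ n) (σ : n ⟶ ⦋1⦌) {X X' Y Y' : C}
    (a : const n.len X' ⟶ (twist E σ).obj (const n.len X))
    (b : (twist E σ).obj (const n.len Y) ⟶ const n.len Y') (z : (mapSpace W X Y).obj (op n)) :
    (mapSpace W X' Y').map θ.op (conj (twist E σ) (levelwise_le_twist E hE σ) a b z) =
      conj (twist E (θ ≫ σ)) (levelwise_le_twist E hE (θ ≫ σ)) ((restrict θ).map a)
        ((restrict θ).map b) ((mapSpace W X Y).map θ.op z) := by
  refine (map_precomp (restrict θ) (levelwise_le_restrict W θ) a _).trans ?_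
  rw [map_comp, map_ofHom]
  obtain ⟨z⟩ := z
  exact congrArg (fun w => ReducedZigzag.precomp _ (ReducedZigzag.comp (Quot.mk _ w) _))
    (z.map_twist_map_restrict E hE θ σ)

/-- The map of mapping spaces induced by the functor `E 1`. -/
noncomputable def mapOne (X Y : C) :
    mapSpace W X Y ⟶ mapSpace W ((E.obj 1).obj X) ((E.obj 1).obj Y) where
  -- Expressing `E 1` as a twist over the constant map 1, with identities at the ends, makes the
  -- comparison in `twistHomotopy_one` free of equalities of functors.
  app Δ := ↾(fun z => conj (twist E (SimplexCategory.const Δ.unop ⦋1⦌ 1))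
    (levelwise_le_twist E hE _) (toTwistOne E _ X) (fromTwist E _ Y) z)
  naturality Δ Δ' θ := by
    ext z
    exact (map_conj_twist E hE θ.unop (SimplexCategory.const Δ.unop ⦋1⦌ 1)
      (toTwistOne E _ X) (fromTwist E _ Y) z).symm

lemma precomp_mapOne {X X' Y : C} (f : X' ⟶ X) :
    precomp W f Y ≫ mapOne E hE X' Y = mapOne E hE X Y ≫ precomp W ((E.obj 1).map f) _ := by
  ext Δ z
  refine (conj_precomp _ _ _ _ _ _).trans ?_
  rw [← map_toTwistOne]
  exact (precomp_conj _ _ _ _ _ _).symm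

/-- The homotopy between the two maps of mapping spaces that are induced by the functors `E 0` and
`E 1` and by the transformation `E 0 ⟶ E 1`. -/
noncomputable def twistHomotopy (X Y : C) :
    mapSpace W X Y ⊗ Δ[1] ⟶ mapSpace W ((E.obj 0).obj X) ((E.obj 1).obj Y) where
  app Δ := ↾(fun z => conj (twist E (SSet.stdSimplex.objEquiv z.2))
    (levelwise_le_twist E hE _) (toTwist E _ X) (fromTwist E _ Y) z.1)
  naturality Δ Δ' θ := by
    ext z
    exact (map_conj_twist E hE θ.unop (SSet.stdSimplex.objEquiv z.2) (toTwist E _ X)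
      (fromTwist E _ Y) z.1).symm

lemma precomp_twistHomotopy {X X' Y : C} (f : X' ⟶ X) :
    precomp W f Y ▷ Δ[1] ≫ twistHomotopy E hE X' Y =
      twistHomotopy E hE X Y ≫ precomp W ((E.obj 0).map f) _ := by
  ext Δ z
  refine (conj_precomp _ _ _ _ _ _).trans ?_
  rw [← map_toTwist]
  exact (precomp_conj _ _ _ _ _ _).symm

/-- Over the constant map 1 the transformation enters only at the source end; the target end is an
identity. -/
lemma twistHomotopy_one (X Y : C) :
    SSet.ι₁ ≫ twistHomotopy E hE X Y = mapOne E hE X Y ≫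
      precomp W ((E.map (homOfLE (Fin.zero_le 1))).app X) _ := by
  ext Δ z
  refine Eq.trans ?_ (precomp_conj _ _ _ _ _ _).symm
  rw [map_comp_toTwistOne]
  rfl

end Twist

/-! ### The start of the homotopy for a unit η -/

section Unit

open Simplicial ReducedZigzag

variable {C : Type u} [Category.{v} C] {T : C ⥤ C} (η : 𝟭 C ⟶ T)

lemma twist_mk₁_zero (m : SimplexCategory) :
    twist (ComposableArrows.mk₁ η) (SimplexCategory.const m ⦋1⦌ 0) = 𝟭 _ := by
  refine CategoryTheory.Functor.ext
    (fun F => CategoryTheory.Functor.ext (fun i => rfl) fun i j g => ?_) fun F G φ => ?_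
  · change ((ComposableArrows.mk₁ η).map (𝟙 0)).app (F.obj i) ≫ F.map g =
      𝟙 (F.obj i) ≫ F.map g ≫ 𝟙 (F.obj j)
    rw [CategoryTheory.Functor.map_id, Category.comp_id]
    rfl
  · ext i
    rw [NatTrans.comp_app, NatTrans.comp_app, eqToHom_app, eqToHom_app]
    change φ.app i = 𝟙 (F.obj i) ≫ φ.app i ≫ 𝟙 (G.obj i)
    rw [Category.id_comp, Category.comp_id]

lemma toTwist_zero (m : SimplexCategory) (X : C) :
    toTwist (ComposableArrows.mk₁ η) (SimplexCategory.const m ⦋1⦌ 0) X ≫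
      eqToHom (congrArg (fun G => G.obj (const m.len X)) (twist_mk₁_zero η m)) = 𝟙 (const m.len X) := by
  ext i
  rw [NatTrans.comp_app, eqToHom_app]
  change ((ComposableArrows.mk₁ η).map (𝟙 0)).app X ≫ 𝟙 X = 𝟙 X
  rw [CategoryTheory.Functor.map_id]
  exact Category.id_comp (𝟙 X)

lemma fromTwist_zero (m : SimplexCategory) (X : C) :
    eqToHom (congrArg (fun G => G.obj (const m.len X)) (twist_mk₁_zero η m).symm) ≫
      fromTwist (ComposableArrows.mk₁ η) (SimplexCategory.const m ⦋1⦌ 0) X =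
        (Functor.const (Fin (m.len + 1))).map (η.app X) := by
  ext i
  rw [NatTrans.comp_app, eqToHom_app]
  exact Category.id_comp (η.app X)

variable {W : MorphismProperty C} [W.IsMultiplicative]

variable {η} in
-- Over the constant map 0 all rows are kept, and η enters only at the target end.
lemma twistHomotopy_zero (hE : ∀ i, W ≤ W.inverseImage ((ComposableArrows.mk₁ η).obj i)) (X Y : C)
    {Δ : SimplexCategoryᵒᵖ} (z : (mapSpace W X Y).obj Δ) :
    (SSet.ι₀ ≫ twistHomotopy _ hE X Y).app Δ z = mapComp z (mapOfHom W (η.app Y) Δ) := by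
  refine (conj_congr (twist_mk₁_zero η Δ.unop) _ le_rfl _ _ _).trans ?_
  refine (congrArg₂ (fun a b => conj _ _ a b _) (toTwist_zero η _ X)
    (fromTwist_zero η _ Y)).trans ?_
  exact conj_id _ _

end Unit

end Hammock

namespace SimplicialMap

open Simplicial

lemma StrictlyHomotopic.of_homotopies {p q : Arrow SSet.{u}} {φ ψ : p ⟶ q} (h : p.left ⊗ Δ[1] ⟶ q.left)
    (h' : p.right ⊗ Δ[1] ⟶ q.right) (w : p.hom ▷ Δ[1] ≫ h' = h ≫ q.hom)
    (h₀ : SSet.ι₀ ≫ h = φ.left) (h₁ : SSet.ι₁ ≫ h = ψ.left)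
    (h₀' : SSet.ι₀ ≫ h' = φ.right) (h₁' : SSet.ι₁ ≫ h' = ψ.right) :
    StrictlyHomotopic φ ψ :=
  -- The homotopies are relative to an empty subcomplex, so the condition `rel` is vacuous.
  ⟨{ h := h, h₀ := h₀, h₁ := h₁, rel := by ext _ ⟨⟨_, h⟩, _⟩; exact h.elim },
    { h := h', h₀ := h₀', h₁ := h₁', rel := by ext _ ⟨⟨_, h⟩, _⟩; exact h.elim }, w⟩

end SimplicialMap

namespace Hammock

/-! ### Postcomposition with vertices and edges, and the retract -/

section Retract

open Simplicial SimplicialMap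

variable {C : Type u} [Category.{v} C] {W : MorphismProperty C} [W.IsMultiplicative]

/-- The map of mapping spaces given by composition with a vertex. -/
noncomputable def postcomp (B : C) {X Y : C} (x : (mapSpace W X Y).obj (op ⦋0⦌)) :
    mapSpace W B X ⟶ mapSpace W B Y where
  app Δ := ↾(fun z => mapComp z (degenerate x Δ))
  naturality Δ Δ' θ := by
    ext z
    exact (congrArg (mapComp _) (map_degenerate x θ).symm).trans (map_mapComp θ _ _).symm

lemma precomp_postcomp {A B : C} (f : A ⟶ B) {X Y : C} (x : (mapSpace W X Y).obj (op ⦋0⦌)) :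
    precomp W f X ≫ postcomp A x = postcomp B x ≫ precomp W f Y := by
  ext Δ z
  exact (precomp_mapComp f z _).symm

/-- The commutative square given by composition with a vertex of a mapping space. -/
noncomputable def postcompArrow {A B : C} (f : A ⟶ B) {X Y : C}
    (x : (mapSpace W X Y).obj (op ⦋0⦌)) :
    Arrow.mk (precomp W f X) ⟶ Arrow.mk (precomp W f Y) :=
  Arrow.homMk (postcomp B x) (postcomp A x) (precomp_postcomp f x).symm

/-- The homotopy given by composition with an edge of a mapping space. -/
noncomputable def postcompHomotopy (B : C) {X Y : C} (w : (mapSpace W X Y).obj (op ⦋1⦌)) :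
    mapSpace W B X ⊗ Δ[1] ⟶ mapSpace W B Y where
  app Δ := ↾(fun z => mapComp z.1 ((mapSpace W X Y).map (SSet.stdSimplex.objEquiv z.2).op w))
  naturality Δ Δ' θ := by
    ext z
    refine (congrArg (mapComp _) ?_).trans (map_mapComp θ _ _).symm
    exact (mapSpace W X Y).map_comp_apply (SSet.stdSimplex.objEquiv z.2).op θ w

lemma precomp_postcompHomotopy {A B : C} (f : A ⟶ B) {X Y : C}
    (w : (mapSpace W X Y).obj (op ⦋1⦌)) :
    precomp W f X ▷ Δ[1] ≫ postcompHomotopy A w = postcompHomotopy B w ≫ precomp W f Y := by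
  ext Δ z
  exact (precomp_mapComp f z.1 _).symm

lemma ι₀_postcompHomotopy (B : C) {X Y : C} (w : (mapSpace W X Y).obj (op ⦋1⦌)) :
    SSet.ι₀ ≫ postcompHomotopy B w =
      postcomp B ((mapSpace W X Y).map (SimplexCategory.const ⦋0⦌ ⦋1⦌ 0).op w) := by
  ext Δ z
  exact congrArg (mapComp _) ((mapSpace W X Y).map_comp_apply
    (SimplexCategory.const ⦋0⦌ ⦋1⦌ 0).op (SimplexCategory.const Δ.unop ⦋0⦌ 0).op w)

lemma ι₁_postcompHomotopy (B : C) {X Y : C} (w : (mapSpace W X Y).obj (op ⦋1⦌)) :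
    SSet.ι₁ ≫ postcompHomotopy B w =
      postcomp B ((mapSpace W X Y).map (SimplexCategory.const ⦋0⦌ ⦋1⦌ 1).op w) := by
  ext Δ z
  exact congrArg (mapComp _) ((mapSpace W X Y).map_comp_apply
    (SimplexCategory.const ⦋0⦌ ⦋1⦌ 1).op (SimplexCategory.const Δ.unop ⦋0⦌ 0).op w)

lemma Edge.strictlyHomotopic {A B : C} (f : A ⟶ B) {X Y : C}
    {x y : (mapSpace W X Y).obj (op ⦋0⦌)} (h : Edge x y) :
    StrictlyHomotopic (postcompArrow f x) (postcompArrow f y) := by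
  obtain ⟨w, rfl, rfl⟩ := h
  exact .of_homotopies (postcompHomotopy B w) (postcompHomotopy A w) (precomp_postcompHomotopy f w)
    (ι₀_postcompHomotopy B w) (ι₁_postcompHomotopy B w) (ι₀_postcompHomotopy A w)
    (ι₁_postcompHomotopy A w)

lemma homotopic_postcompArrow {A B : C} (f : A ⟶ B) {X Y : C}
    {x y : (mapSpace W X Y).obj (op ⦋0⦌)} (h : Relation.EqvGen Edge x y) :
    Homotopic (postcompArrow f x) (postcompArrow f y) := by
  induction h with
  | rel x y h => exact .rel _ _ (h.strictlyHomotopic f)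
  | refl x => exact .refl _
  | symm x y h ih => exact .symm _ _ ih
  | trans x y z h h' ih ih' => exact .trans _ _ _ ih ih'

lemma postcompArrow_id {A B : C} (f : A ⟶ B) (X : C) :
    postcompArrow f (mapOfHom W (𝟙 X) _) = 𝟙 _ := by
  ext Δ z
  · exact mapComp_mapOfHom_id z
  · exact mapComp_mapOfHom_id z

theorem isHomotopyRetract_precomp {T : C ⥤ C} (η : 𝟭 C ⟶ T) (hT : W ≤ W.inverseImage T) {X : C}
    (a : (mapSpace W (T.obj X) X).obj (op ⦋0⦌))
    (ha : Relation.EqvGen Edge (mapComp (mapOfHom W (η.app X) _) a) (mapOfHom W (𝟙 X) _))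
    {A B : C} (f : A ⟶ B) :
    IsHomotopyRetract (Arrow.mk (precomp W f X)) (Arrow.mk (precomp W (T.map f) X)) := by
  have hE : ∀ i, W ≤ W.inverseImage ((ComposableArrows.mk₁ η).obj i) := fun i => by
    fin_cases i
    · exact le_rfl
    · exact hT
  let E := ComposableArrows.mk₁ η
  let i : Arrow.mk (precomp W f X) ⟶ Arrow.mk (precomp W (T.map f) X) :=
    -- i(z) = T z · a
    Arrow.homMk (mapOne E hE B X ≫ postcomp _ a) (mapOne E hE A X ≫ postcomp _ a) (by
      ext Δ z
      refine (precomp_mapComp _ _ _).trans (congrArg (mapComp · (degenerate a Δ)) ?_)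
      exact congrArg (fun φ => φ.app Δ z) (precomp_mapOne E hE f).symm)
  let r : Arrow.mk (precomp W (T.map f) X) ⟶ Arrow.mk (precomp W f X) :=
    Arrow.homMk (precomp W (η.app B) X) (precomp W (η.app A) X) (by
      ext Δ z
      refine (precomp_app_precomp_app _ _ _).trans ((precomp_app_precomp_app _ _ _).trans ?_).symm
      rw [← η.naturality]
      rfl)
  have h₀ (Y : C) : SSet.ι₀ ≫ twistHomotopy E hE Y X ≫ postcomp _ a =
      postcomp Y (mapComp (mapOfHom W (η.app X) _) a) := by
    ext Δ z
    refine (congrArg (mapComp · (degenerate a Δ)) (twistHomotopy_zero hE Y X z)).trans ?_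
    exact (mapComp_assoc _ _ _).trans
      (congrArg (mapComp _) (degenerate_mapComp (mapOfHom W (η.app X) _) a Δ).symm)
  have h₁ (Y : C) : SSet.ι₁ ≫ twistHomotopy E hE Y X ≫ postcomp _ a =
      (mapOne E hE Y X ≫ postcomp _ a) ≫ precomp W (η.app Y) X := by
    ext Δ z
    refine Eq.trans ?_ (precomp_mapComp _ _ _).symm
    exact congrArg (fun φ => mapComp (φ.app Δ z) (degenerate a Δ)) (twistHomotopy_one E hE Y X)
  -- The homotopy from z · η to η · T z, composed on the right with a.
  have h : StrictlyHomotopic (postcompArrow f (mapComp (mapOfHom W (η.app X) _) a)) (i ≫ r) := by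
    refine .of_homotopies (twistHomotopy E hE B X ≫ postcomp _ a) (twistHomotopy E hE A X ≫ postcomp _ a) ?_
      (h₀ B) (h₁ B) (h₀ A) (h₁ A)
    ext Δ z
    refine Eq.trans ?_ (precomp_mapComp _ _ _).symm
    exact congrArg (fun φ => mapComp (φ.app Δ z) (degenerate a Δ)) (precomp_twistHomotopy E hE f)
  have h' : Homotopic (postcompArrow f (mapComp (mapOfHom W (η.app X) _) a)) (𝟙 _) :=
    (postcompArrow_id f X).subst (motive := fun φ => Homotopic _ φ)
      (homotopic_postcompArrow f ha)
  exact ⟨i, r, .trans _ _ _ (.symm _ _ (.rel _ _ h)) h'⟩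

end Retract

/-! ### From the unit law in the homotopy category to a vertex -/

section Vertex

open Simplicial

variable {C : Type u} [Category.{v} C] (W : MorphismProperty C) [W.IsMultiplicative]

/-- The universal property of L gives a functor from H to the category of components. The vertex x
is any representative of the image of a. Equality of components yields a zigzag of edges, which is
why the conclusion is stated with `Relation.EqvGen`. -/
lemma exists_vertex_of_localization {H : Type u'} [Category.{v'} H] (L : C ⥤ H)
    [L.IsLocalization W] {X Y : C} (g : X ⟶ Y) (a : L.obj Y ⟶ L.obj X)
    (h : L.map g ≫ a = 𝟙 _) :
    ∃ x : (mapSpace W Y X).obj (op ⦋0⦌),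
      Relation.EqvGen Edge (mapComp (mapOfHom W g _) x) (mapOfHom W (𝟙 X) _) := by
  let Φ := Localization.lift (toComponentCat W) toComponentCat_inverts L
  let ε : L ⋙ Φ ≅ toComponentCat W := Localization.fac _ _ L
  obtain ⟨x, hx⟩ := Quot.exists_rep (ε.inv.app Y ≫ Φ.map a ≫ ε.hom.app X)
  refine ⟨x, Quot.eqvGen_exact ?_⟩
  change (toComponentCat W).map g ≫ Quot.mk _ x = 𝟙 ((toComponentCat W).obj X)
  rw [hx, ← Category.assoc, ε.inv.naturality, Category.assoc, Functor.comp_map,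
    ← Category.assoc (Φ.map _), ← Functor.map_comp, h, CategoryTheory.Functor.map_id]
  erw [Category.id_comp]
  exact ε.inv_hom_id_app X

end Vertex

end Hammock

/-- The structure map is carried along e to an arrow out of L (T X); naturality of the induced unit
reduces the claim to the unit law of P. -/
lemma exists_retraction_of_algebra {C : Type u} [Category.{v} C] {H : Type u'} [Category.{v'} H]
    (W : MorphismProperty C) (L : C ⥤ H) [L.IsLocalization W] (T : CategoryTheory.Monad C)
    (hT : W ≤ W.inverseImage T.toFunctor) (P : (hoMonad W L T hT).Algebra) (X : C)
    (e : L.obj X ≅ P.A) :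
    ∃ a : L.obj (T.obj X) ⟶ L.obj X, L.map (T.η.app X) ≫ a = 𝟙 _ := by
  refine ⟨(hoFunctorIso W L T hT).inv.app X ≫ (hoFunctor W L T hT).map e.hom ≫ P.a ≫ e.inv, ?_⟩
  have h₁ : e.hom ≫ (hoUnit W L T hT).app P.A =
      (hoUnit W L T hT).app (L.obj X) ≫ (hoFunctor W L T hT).map e.hom :=
    (hoUnit W L T hT).naturality e.hom
  have h₂ : (hoUnit W L T hT).app P.A ≫ P.a = 𝟙 _ := P.unit
  calc _ = ((hoUnit W L T hT).app (L.obj X) ≫ (hoFunctor W L T hT).map e.hom) ≫ P.a ≫ e.inv := by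
        rw [hoUnit_app]
        simp only [Category.assoc]
    _ = e.hom ≫ ((hoUnit W L T hT).app P.A ≫ P.a) ≫ e.inv := by
        rw [← h₁]
        exact (Category.assoc _ _ _).trans (congrArg (e.hom ≫ ·) (Category.assoc _ _ _).symm)
    _ = 𝟙 _ := by
        rw [h₂]
        exact (congrArg (e.hom ≫ ·) (Category.id_comp _)).trans e.hom_inv_id

theorem theorem4p1 {M : Type u} [Category.{v} M] [ModelCategory M]
    (T : CategoryTheory.Monad M)
    (hT : weakEquivalences M ≤ (weakEquivalences M).inverseImage T.toFunctor)
    {H : Type u'} [Category.{v'} H] (L : M ⥤ H) [L.IsLocalization (weakEquivalences M)]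
    (P : (hoMonad (weakEquivalences M) L T hT).Algebra) (X : M) (e : L.obj X ≅ P.A)
    {A B : M} (f : A ⟶ B) :
    SimplicialMap.IsHomotopyRetract
      (Arrow.mk (Hammock.precomp (weakEquivalences M) f X))
      (Arrow.mk (Hammock.precomp (weakEquivalences M) (T.map f) X)) := by
  obtain ⟨a, ha⟩ := exists_retraction_of_algebra (weakEquivalences M) L T hT P X e
  obtain ⟨x, hx⟩ := Hammock.exists_vertex_of_localization (weakEquivalences M) L _ a ha
  exact Hammock.isHomotopyRetract_precomp T.η hT x hx f
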